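/- **Setting.** Let $p,q$ be positive integers. Let $(\bar M,\bar g)$ be a smooth semi-Riemannian manifold of dimension $m+n$ (so $\bar g$ is a smooth symmetric nondegenerate $(0,2)$-tensor field of constant index) with Levi-Civita connection $\bar\nabla$, and let $\bar J$ be a metallic structure on it: a smooth $(1,1)$-tensor field with $\bar J^2=p\bar J+qI$ and $\bar g(U,\bar JV)=\bar g(\bar JU,V)$. Let $\eta$ be a smooth vector field on $\bar M$, $\pi(V)=\bar g(V,\eta)$, and let $\bar D$ be the quarter symmetric non-metric connection $$\bar D_UV=\bar\nabla_UV+\pi(V)\,\bar JU .$$ Let $M$ be an $m$-dimensional (immersed) $r$-lightlike submanifold of $\bar M$, $r>0$: $\operatorname{Rad}TM=TM\cap TM^\perp$ has constant rank $r$. Fix smooth bundles $S(TM)$ (a screen distribution), $S(TM^\perp)$ (a screen transversal bundle) and $\mathrm{ltr}(TM)$ (a lightlike transversal bundle) with $$TM=\operatorname{Rad}TM\oplus S(TM),\qquad TM^\perp=\operatorname{Rad}TM\oplus S(TM^\perp),\qquad S(TM)^\perp\cap S(TM^\perp)^\perp=\operatorname{Rad}TM\oplus \mathrm{ltr}(TM),$$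 where $\bar g$ vanishes on $\mathrm{ltr}(TM)$. Then $T\bar M|_M=TM\oplus \mathrm{tr}(TM)$ with $\mathrm{tr}(TM)=\mathrm{ltr}(TM)\oplus S(TM^\perp)$. For vector fields $U,V$ on $M$, let $D_UV$ be the $TM$-component of $\bar D_UV$ in this decomposition, and for $V\in\Gamma(S(TM))$ let $\bar h^*(U,V)$ be the $\operatorname{Rad}TM$-component of $D_UV$ in $TM=\operatorname{Rad}TM\oplus S(TM)$. Assume that $M$ is invariant, i.e. $\bar J(\operatorname{Rad}TM)=\operatorname{Rad}TM$ and $\bar J(S(TM))=S(TM)$. **Theorem.** The screen distribution $S(TM)$ defines a totally geodesic foliation of $M$ with respect to $D$ (that is, $S(TM)$ is integrable, meaning closed under the Lie bracket, and $D_UV\in\Gamma(S(TM))$ for all $U,V\in\Gamma(S(TM))$) if and only if $$\bar h^*(U,\bar JV)=p\,\bar h^*(U,V)\qquad\text{for all }U,V\in\Gamma(S(TM)).$$ -/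

import Mathlib

open scoped Manifold ContDiff

noncomputable section

namespace LightlikeGeometry

/-! ## Ambient geometry: semi-Riemannian metrics, metallic structures, connections -/

section Ambient

variable {d : ℕ} {N : Type*} [TopologicalSpace N] [ChartedSpace (EuclideanSpace ℝ (Fin d)) N]
  [IsManifold (𝓡 d) ∞ N]

variable (d N) in
/-- A smooth semi-Riemannian metric on a `d`-dimensional manifold `N`: a smooth symmetric
nondegenerate `(0,2)`-tensor field of constant index, the index at a point being the largest
dimension of a negative definite subspace of the tangent space. -/
structure SemiRiemannianMetric where
  inner (y : N) : TangentSpace (𝓡 d) y →L[ℝ] TangentSpace (𝓡 d) y →L[ℝ] ℝ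
  symm (y : N) (v w : TangentSpace (𝓡 d) y) : inner y v w = inner y w v
  nondegenerate (y : N) (v : TangentSpace (𝓡 d) y) (hv : ∀ w, inner y v w = 0) : v = 0
  contMDiff : ContMDiff (𝓡 d)
    ((𝓡 d).prod 𝓘(ℝ, EuclideanSpace ℝ (Fin d) →L[ℝ] EuclideanSpace ℝ (Fin d) →L[ℝ] ℝ)) ∞
    (fun y ↦ Bundle.TotalSpace.mk'
      (EuclideanSpace ℝ (Fin d) →L[ℝ] EuclideanSpace ℝ (Fin d) →L[ℝ] ℝ)
      (E := fun y : N ↦ TangentSpace (𝓡 d) y →L[ℝ] TangentSpace (𝓡 d) y →L[ℝ] ℝ) y (inner y))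
  index : ℕ
  index_eq (y : N) : IsGreatest
    {k : ℕ | ∃ P : Submodule ℝ (TangentSpace (𝓡 d) y), Module.finrank ℝ P = k ∧
      ∀ v ∈ P, v ≠ 0 → inner y v v < 0} index

/-- The metric at a point, as a bilinear form. -/
def SemiRiemannianMetric.bilin (g : SemiRiemannianMetric d N) (y : N) :
    LinearMap.BilinForm ℝ (TangentSpace (𝓡 d) y) :=
  LinearMap.mk₂ ℝ (fun v w ↦ g.inner y v w) (by simp) (by simp) (by simp) (by simp)

/-- A metallic structure with parameters `p, q` on a semi-Riemannian manifold `(N, g)`: a smooth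
`(1,1)`-tensor field `J` with `J² = p J + q I` for which `g` is `J`-compatible. -/
structure MetallicStructure (g : SemiRiemannianMetric d N) (p q : ℕ) where
  toFun (y : N) : TangentSpace (𝓡 d) y →L[ℝ] TangentSpace (𝓡 d) y
  contMDiff : ContMDiff (𝓡 d)
    ((𝓡 d).prod 𝓘(ℝ, EuclideanSpace ℝ (Fin d) →L[ℝ] EuclideanSpace ℝ (Fin d))) ∞
    (fun y ↦ Bundle.TotalSpace.mk'
      (EuclideanSpace ℝ (Fin d) →L[ℝ] EuclideanSpace ℝ (Fin d))
      (E := fun y : N ↦ TangentSpace (𝓡 d) y →L[ℝ] TangentSpace (𝓡 d) y) y (toFun y))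
  sq (y : N) (v : TangentSpace (𝓡 d) y) :
    toFun y (toFun y v) = (p : ℝ) • toFun y v + (q : ℝ) • v
  compatible (y : N) (v w : TangentSpace (𝓡 d) y) :
    g.inner y v (toFun y w) = g.inner y (toFun y v) w

variable (d N) in
/-- Linear connections on the manifold `N`. For `D : LinearConnection d N`, the value `D Y y v` is
the derivative `D_v Y` of the field `Y` at `y` in the direction `v`. -/
abbrev LinearConnection :=
  CovariantDerivative (𝓡 d) (EuclideanSpace ℝ (Fin d)) (TangentSpace (𝓡 d) : N → Type _)

/-- `D` is the Levi-Civita connection of `g`: it is torsion free and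
`v (g(Y, Z)) = g(D_v Y, Z) + g(Y, D_v Z)`. -/
structure IsLeviCivita (g : SemiRiemannianMetric d N) (D : LinearConnection d N) : Prop where
  torsion_free ⦃X Y : ∀ y : N, TangentSpace (𝓡 d) y⦄ ⦃y : N⦄
    (hX : MDifferentiableAt (𝓡 d) (𝓡 d).tangent
      (fun z ↦ (⟨z, X z⟩ : TangentBundle (𝓡 d) N)) y)
    (hY : MDifferentiableAt (𝓡 d) (𝓡 d).tangent
      (fun z ↦ (⟨z, Y z⟩ : TangentBundle (𝓡 d) N)) y) :
    D Y y (X y) - D X y (Y y) = VectorField.mlieBracket (𝓡 d) X Y y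
  metric ⦃Y Z : ∀ y : N, TangentSpace (𝓡 d) y⦄ ⦃y : N⦄
    (hY : MDifferentiableAt (𝓡 d) (𝓡 d).tangent
      (fun z ↦ (⟨z, Y z⟩ : TangentBundle (𝓡 d) N)) y)
    (hZ : MDifferentiableAt (𝓡 d) (𝓡 d).tangent
      (fun z ↦ (⟨z, Z z⟩ : TangentBundle (𝓡 d) N)) y)
    (v : TangentSpace (𝓡 d) y) :
    mfderiv (𝓡 d) 𝓘(ℝ, ℝ) (fun z ↦ g.inner z (Y z) (Z z)) y v =
      g.inner y (D Y y v) (Z y) + g.inner y (Y y) (D Z y v)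

/-- The quarter symmetric non-metric connection
`D̄_U V = ∇_U V + π(V) J U`, where `π(V) = g(V, η)`, built from a connection `∇`. -/
def quarterSymmetric {g : SemiRiemannianMetric d N} {p q : ℕ} (J : MetallicStructure g p q)
    (nabla : LinearConnection d N) (eta : ∀ y : N, TangentSpace (𝓡 d) y) :
    LinearConnection d N where
  toFun Y y := nabla Y y + g.inner y (Y y) (eta y) • J.toFun y
  isCovariantDerivativeOnUniv :=
    { add := fun hσ hσ' _ ↦ by
        rw [nabla.isCovariantDerivativeOnUniv.add hσ hσ']
        simp only [Pi.add_apply, map_add, _root_.add_apply, add_smul]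
        abel
      leibniz := fun {σ a x} hσ ha _ ↦ by
        rw [nabla.isCovariantDerivativeOnUniv.leibniz hσ ha]
        have h : g.inner x ((a • σ) x) (eta x) = a x * g.inner x (σ x) (eta x) := by
          change g.inner x (a x • σ x) (eta x) = _
          rw [map_smul]
          rfl
        rw [h, smul_add, mul_smul]
        abel }

end Ambient

/-! ## Fields along a map -/

section Along

variable {m d : ℕ} {M : Type*} [TopologicalSpace M] [ChartedSpace (EuclideanSpace ℝ (Fin m)) M]
  [IsManifold (𝓡 m) ∞ M]
  {N : Type*} [TopologicalSpace N] [ChartedSpace (EuclideanSpace ℝ (Fin d)) N]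
  [IsManifold (𝓡 d) ∞ N]

/-- `P` is a smooth vector subbundle of `f^*TN`: near every point it is spanned by finitely many
smooth, pointwise linearly independent sections. For `f = id` these are the smooth distributions
on `N`. -/
def IsSmoothSubbundleAlong (f : M → N) (P : ∀ x : M, Submodule ℝ (TangentSpace (𝓡 d) (f x))) :
    Prop :=
  ∀ x₀ : M, ∃ u : Set M, IsOpen u ∧ x₀ ∈ u ∧
    ∃ (k : ℕ) (s : Fin k → ∀ x : M, TangentSpace (𝓡 d) (f x)),
      (∀ i, ContMDiffOn (𝓡 m) (𝓡 d).tangent ∞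
        (fun x ↦ (⟨f x, s i x⟩ : TangentBundle (𝓡 d) N)) u) ∧
      ∀ x ∈ u, LinearIndependent ℝ (fun i ↦ s i x) ∧
        Submodule.span ℝ (Set.range fun i ↦ s i x) = P x

/-- A smooth distribution on `M`. -/
def IsSmoothDistribution (P : ∀ x : M, Submodule ℝ (TangentSpace (𝓡 m) x)) : Prop :=
  IsSmoothSubbundleAlong (m := m) (d := m) (id : M → M) P

/-- `V ∈ Γ(P)`: the vector field `V` is smooth on `M` and takes its values in `P`. -/
structure IsSection (P : ∀ x : M, Submodule ℝ (TangentSpace (𝓡 m) x))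
    (V : ∀ x : M, TangentSpace (𝓡 m) x) : Prop where
  smooth : ContMDiff (𝓡 m) (𝓡 m).tangent ∞ (fun x ↦ (⟨x, V x⟩ : TangentBundle (𝓡 m) M))
  mem (x : M) : V x ∈ P x

/-- The derivative `D_u W` at `x`, in the direction `u ∈ T_x M`, of a field `W` along `f : M → N`
for a linear connection `D` on `N` (the pullback connection on `f^*TN`).

In the coordinates of `TN` around `f x` one has `W y = ∑ᵢ cⁱ(y) ∂ᵢ` and
`D_u W = ∑ᵢ dcⁱ(u) ∂ᵢ + ∑ᵢ cⁱ(x) D_{df u} ∂ᵢ`. Below, `c` is the coordinate vector of `W`, and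
`e.symmL ℝ z w` is the field with constant coordinate vector `w`. -/
def derivAlong (D : LinearConnection d N) (f : M → N) (W : ∀ x : M, TangentSpace (𝓡 d) (f x))
    (x : M) (u : TangentSpace (𝓡 m) x) : TangentSpace (𝓡 d) (f x) :=
  let e := trivializationAt (EuclideanSpace ℝ (Fin d)) (TangentSpace (𝓡 d) : N → Type _) (f x)
  let c : M → EuclideanSpace ℝ (Fin d) := fun y ↦ (e (⟨f y, W y⟩ : TangentBundle (𝓡 d) N)).2
  e.symmL ℝ (f x) (mfderiv (𝓡 m) 𝓘(ℝ, EuclideanSpace ℝ (Fin d)) c x u) +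
    D (fun z ↦ e.symmL ℝ z (c x)) (f x) (mfderiv (𝓡 m) (𝓡 d) f x u)

end Along

/-! ## Lightlike submanifolds -/

section Lightlike

variable {m d : ℕ} {M : Type*} [TopologicalSpace M] [ChartedSpace (EuclideanSpace ℝ (Fin m)) M]
  [IsManifold (𝓡 m) ∞ M]
  {N : Type*} [TopologicalSpace N] [ChartedSpace (EuclideanSpace ℝ (Fin d)) N]
  [IsManifold (𝓡 d) ∞ N]

/-- The differential of `f` at `x`. -/
def dmap (m d : ℕ) [ChartedSpace (EuclideanSpace ℝ (Fin m)) M]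
    [ChartedSpace (EuclideanSpace ℝ (Fin d)) N] (f : M → N) (x : M) :
    TangentSpace (𝓡 m) x →ₗ[ℝ] TangentSpace (𝓡 d) (f x) :=
  (mfderiv (𝓡 m) (𝓡 d) f x).toLinearMap

/-- `TM^⊥` at `x`, as a subspace of the ambient tangent space. -/
def normalSpace (m : ℕ) [ChartedSpace (EuclideanSpace ℝ (Fin m)) M]
    (g : SemiRiemannianMetric d N) (f : M → N) (x : M) :
    Submodule ℝ (TangentSpace (𝓡 d) (f x)) :=
  (g.bilin (f x)).orthogonal (LinearMap.range (dmap m d f x))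

/-- `Rad TM = TM ∩ TM^⊥` at `x`, as a subspace of `T_x M`. -/
def radical (m : ℕ) [ChartedSpace (EuclideanSpace ℝ (Fin m)) M]
    (g : SemiRiemannianMetric d N) (f : M → N) (x : M) :
    Submodule ℝ (TangentSpace (𝓡 m) x) :=
  (LinearMap.range (dmap m d f x) ⊓ normalSpace m g f x).comap (dmap m d f x)

variable (m) in
/-- An `r`-lightlike submanifold `(M, g, S(TM), S(TM^⊥))`, `r > 0`, immersed in the
semi-Riemannian manifold `(N, g)` by `f`, together with a lightlike transversal bundle `ltr(TM)`. -/
structure LightlikeSubmanifold (g : SemiRiemannianMetric d N) (f : M → N) (r : ℕ) where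
  smooth : ContMDiff (𝓡 m) (𝓡 d) ∞ f
  immersion (x : M) : Function.Injective (mfderiv (𝓡 m) (𝓡 d) f x)
  r_pos : 0 < r
  rank_radical (x : M) : Module.finrank ℝ (radical m g f x) = r
  /-- The screen distribution `S(TM)`, complementary to `Rad TM` in `TM`. -/
  screen (x : M) : Submodule ℝ (TangentSpace (𝓡 m) x)
  screen_smooth : IsSmoothDistribution screen
  screen_compl (x : M) : IsCompl (radical m g f x) (screen x)
  /-- The screen transversal bundle `S(TM^⊥)`, complementary to `Rad TM` in `TM^⊥`. -/
  screenTrans (x : M) : Submodule ℝ (TangentSpace (𝓡 d) (f x))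
  screenTrans_smooth : IsSmoothSubbundleAlong (m := m) f screenTrans
  screenTrans_disjoint (x : M) : Disjoint ((radical m g f x).map (dmap m d f x)) (screenTrans x)
  screenTrans_sup (x : M) :
    (radical m g f x).map (dmap m d f x) ⊔ screenTrans x = normalSpace m g f x
  /-- The lightlike transversal bundle `ltr(TM)`, an isotropic bundle complementary to `Rad TM` in
  the orthogonal complement of `S(TM^⊥)` in `S(TM)^⊥`. -/
  ltr (x : M) : Submodule ℝ (TangentSpace (𝓡 d) (f x))
  ltr_smooth : IsSmoothSubbundleAlong (m := m) f ltr
  ltr_disjoint (x : M) : Disjoint ((radical m g f x).map (dmap m d f x)) (ltr x)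
  ltr_sup (x : M) : (radical m g f x).map (dmap m d f x) ⊔ ltr x =
    (g.bilin (f x)).orthogonal ((screen x).map (dmap m d f x)) ⊓
      (g.bilin (f x)).orthogonal (screenTrans x)
  ltr_isotropic (x : M) (v w : TangentSpace (𝓡 d) (f x)) (hv : v ∈ ltr x) (hw : w ∈ ltr x) :
    g.inner (f x) v w = 0

namespace LightlikeSubmanifold

variable {g : SemiRiemannianMetric d N} {f : M → N} {r : ℕ} (L : LightlikeSubmanifold m g f r)

/-- The transversal bundle `tr(TM) = ltr(TM) ⊥ S(TM^⊥)`. -/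
def trans (x : M) : Submodule ℝ (TangentSpace (𝓡 d) (f x)) := L.ltr x ⊔ L.screenTrans x

/-- `TN|_M = TM ⊕ tr(TM)`. -/
theorem isCompl_trans (x : M) : IsCompl (LinearMap.range (dmap m d f x)) (L.trans x) := by
  have : FiniteDimensional ℝ (TangentSpace (𝓡 d) (f x)) :=
    inferInstanceAs (FiniteDimensional ℝ (EuclideanSpace ℝ (Fin d)))
  set B := g.bilin (f x) with hB
  have hsymm : ∀ v w, B v w = B w v := fun v w ↦ g.symm (f x) v w
  have hrefl : B.IsRefl := fun v w h ↦ by rw [hsymm, h]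
  have hnd : B.Nondegenerate := by
    refine (LinearMap.IsRefl.nondegenerate_iff_separatingLeft hrefl).2 ?_
    exact fun v hv ↦ g.nondegenerate (f x) v hv
  set T := LinearMap.range (dmap m d f x) with hT
  set R := (radical m g f x).map (dmap m d f x) with hR
  set S := (L.screen x).map (dmap m d f x) with hS
  set W := L.screenTrans x with hW
  have hRn : R = T ⊓ B.orthogonal T := by
    rw [hR, radical, Submodule.map_comap_eq]
    exact inf_eq_right.2 inf_le_left
  have hRS : R ⊔ S = T := by
    rw [hR, hS, ← Submodule.map_sup, (L.screen_compl x).sup_eq_top, Submodule.map_top]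
  have hRSd : Disjoint R S :=
    Submodule.disjoint_map (L.immersion x) (L.screen_compl x).disjoint
  have hST : S ≤ T := hRS ▸ le_sup_right
  have hRT : R ≤ T := hRS ▸ le_sup_left
  have hRW : R ⊔ W = B.orthogonal T := L.screenTrans_sup x
  have hWT : W ≤ B.orthogonal T := hRW ▸ le_sup_right
  have hltr : R ⊔ L.ltr x = B.orthogonal S ⊓ B.orthogonal W := L.ltr_sup x
  have hle : L.ltr x ≤ B.orthogonal S ⊓ B.orthogonal W := hltr ▸ le_sup_right
  have hlS : ∀ l ∈ L.ltr x, ∀ s ∈ S, B s l = 0 := fun l hl s hs ↦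
    (Submodule.mem_inf.1 (hle hl)).1 s hs
  have hlW : ∀ l ∈ L.ltr x, ∀ s ∈ W, B s l = 0 := fun l hl s hs ↦
    (Submodule.mem_inf.1 (hle hl)).2 s hs
  have hTW : ∀ t ∈ T, ∀ w ∈ W, B t w = 0 := fun t ht w hw ↦ hWT hw t ht
  have hRT0 : ∀ t ∈ T, ∀ v ∈ R, B t v = 0 := fun t ht v hv ↦ by
    rw [hRn] at hv
    exact hv.2 t ht
  -- `S` and `W` are nondegenerate
  have hSd : Disjoint S (B.orthogonal S) := by
    rw [Submodule.disjoint_def]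
    intro v hv hvo
    refine Submodule.disjoint_def.1 hRSd v ?_ hv
    rw [hRn]
    refine ⟨hST hv, fun t ht ↦ ?_⟩
    rw [← hRS] at ht
    obtain ⟨a, ha, b, hb, rfl⟩ := Submodule.mem_sup.1 ht
    have h1 : B a v = 0 := by rw [hsymm]; exact hRT0 v (hST hv) a ha
    have h2 : B b v = 0 := hvo b hb
    change B (a + b) v = 0
    rw [map_add, LinearMap.add_apply, h1, h2, add_zero]
  have hWd : Disjoint W (B.orthogonal W) := by
    rw [Submodule.disjoint_def]
    intro v hv hvo
    refine Submodule.disjoint_def.1 (L.screenTrans_disjoint x) v ?_ hv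
    change v ∈ R
    rw [hRn]
    refine ⟨?_, hWT hv⟩
    rw [← LinearMap.BilinForm.orthogonal_orthogonal hnd hrefl T, ← hRW]
    intro t ht
    obtain ⟨a, ha, b, hb, rfl⟩ := Submodule.mem_sup.1 ht
    have h1 : B a v = 0 := hTW a (hRT ha) v hv
    have h2 : B b v = 0 := hvo b hb
    change B (a + b) v = 0
    rw [map_add, LinearMap.add_apply, h1, h2, add_zero]
  have hSc := (LinearMap.BilinForm.isCompl_orthogonal_iff_disjoint hrefl).2 hSd
  have hWc := (LinearMap.BilinForm.isCompl_orthogonal_iff_disjoint hrefl).2 hWd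
  have hmem : ∀ v, v ∈ L.trans x → ∃ l ∈ L.ltr x, ∃ w ∈ W, l + w = v := fun v hv ↦
    Submodule.mem_sup.1 hv
  constructor
  · rw [Submodule.disjoint_def]
    intro v hvT hv
    obtain ⟨l, hl, w, hw, rfl⟩ := hmem v hv
    rw [← hRS] at hvT
    obtain ⟨a, ha, s, hs, hv⟩ := Submodule.mem_sup.1 hvT
    have hs0 : s = 0 := by
      refine Submodule.disjoint_def.1 hSd s hs fun t ht ↦ ?_
      have h : B t (a + s) = B t (l + w) := by rw [hv]
      rw [map_add, map_add, hRT0 t (hST ht) a ha, hlS l hl t ht, hTW t (hST ht) w hw] at h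
      simpa using h
    subst hs0
    have hw0 : w = 0 := by
      refine Submodule.disjoint_def.1 hWd w hw fun t ht ↦ ?_
      have h : B t (a + 0) = B t (l + w) := by rw [hv]
      rw [add_zero, map_add, hlW l hl t ht, hsymm t a, hTW a (hRT ha) t ht] at h
      simpa using h.symm
    subst hw0
    simp only [add_zero] at hv ⊢
    exact Submodule.disjoint_def.1 (L.ltr_disjoint x) l (hv ▸ ha) hl
  · rw [codisjoint_iff, eq_top_iff]
    intro v _
    obtain ⟨s, hs, v', hv', rfl⟩ := Submodule.mem_sup.1 (hSc.sup_eq_top ▸ Submodule.mem_top :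
      v ∈ S ⊔ B.orthogonal S)
    obtain ⟨w, hw, u, hu, rfl⟩ := Submodule.mem_sup.1 (hWc.sup_eq_top ▸ Submodule.mem_top :
      v' ∈ W ⊔ B.orthogonal W)
    have hu' : u ∈ R ⊔ L.ltr x := by
      rw [hltr]
      refine ⟨fun t ht ↦ ?_, hu⟩
      have h : B t (w + u) = 0 := hv' t ht
      rw [map_add, hTW t (hST ht) w hw, zero_add] at h
      exact h
    obtain ⟨a, ha, l, hl, rfl⟩ := Submodule.mem_sup.1 hu'
    have h1 : s + a ∈ T := add_mem (hST hs) (hRT ha)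
    have h2 : l + w ∈ L.trans x := add_mem (Submodule.mem_sup_left hl) (Submodule.mem_sup_right hw)
    have h3 : s + (w + (a + l)) = (s + a) + (l + w) := by abel
    rw [h3]
    exact Submodule.add_mem_sup h1 h2

/-- The projection of `TN|_M = TM ⊕ tr(TM)` onto `TM`. -/
def tangentPart (x : M) : TangentSpace (𝓡 d) (f x) →ₗ[ℝ] TangentSpace (𝓡 m) x :=
  LinearMap.linearProjOfIsCompl (L.trans x) (dmap m d f x) (L.immersion x) (L.isCompl_trans x)

/-- The induced connection `D_U V` on `M`: the tangential part in the Gauss formula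
`D̄_U V = D_U V + h̄^l(U, V) + h̄^s(U, V)`. -/
def induced (Dbar : LinearConnection d N) (U V : ∀ x : M, TangentSpace (𝓡 m) x) (x : M) :
    TangentSpace (𝓡 m) x :=
  L.tangentPart x (derivAlong Dbar f (fun y ↦ dmap m d f y (V y)) x (U x))

/-- The projection of `TM = Rad TM ⊥ S(TM)` onto `Rad TM`. -/
def radPart (x : M) : TangentSpace (𝓡 m) x →ₗ[ℝ] TangentSpace (𝓡 m) x :=
  (radical m g f x).projection (L.screen x) (L.screen_compl x)

/-- `h̄^*(U, V)` for `V ∈ Γ(S(TM))`: the radical part in `D_U V = D^*_U V + h̄^*(U, V)`. -/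
def hStar (Dbar : LinearConnection d N) (U V : ∀ x : M, TangentSpace (𝓡 m) x) (x : M) :
    TangentSpace (𝓡 m) x :=
  L.radPart x (L.induced Dbar U V x)

/-- The field `J V` on `M` for a field `V` on `M`: the tangential part of `J V`, which is all of
`J V` whenever `J V` is tangent to `M`. -/
def tangentJ {p q : ℕ} (J : MetallicStructure g p q) (V : ∀ x : M, TangentSpace (𝓡 m) x) (x : M) :
    TangentSpace (𝓡 m) x :=
  L.tangentPart x (J.toFun (f x) (dmap m d f x (V x)))

/-- `M` is invariant: `J (Rad TM) = Rad TM` and `J S(TM) = S(TM)`. -/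
structure IsInvariant {p q : ℕ} (J : MetallicStructure g p q) : Prop where
  radical (x : M) :
    ((radical m g f x).map (dmap m d f x)).map (J.toFun (f x)).toLinearMap =
      (radical m g f x).map (dmap m d f x)
  screen (x : M) :
    ((L.screen x).map (dmap m d f x)).map (J.toFun (f x)).toLinearMap =
      (L.screen x).map (dmap m d f x)

/-- `S(TM)` defines a totally geodesic foliation of `M` with respect to the connection induced by
`Dbar`: it is integrable (involutive), and its leaves are totally geodesic, that is
`D_U V ∈ Γ(S(TM))` for all `U, V ∈ Γ(S(TM))`. -/
structure ScreenTotallyGeodesicFoliation (Dbar : LinearConnection d N) : Prop where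
  integrable ⦃U V : ∀ x : M, TangentSpace (𝓡 m) x⦄ (hU : IsSection L.screen U)
    (hV : IsSection L.screen V) (x : M) : VectorField.mlieBracket (𝓡 m) U V x ∈ L.screen x
  totally_geodesic ⦃U V : ∀ x : M, TangentSpace (𝓡 m) x⦄ (hU : IsSection L.screen U)
    (hV : IsSection L.screen V) (x : M) : L.induced Dbar U V x ∈ L.screen x

end LightlikeSubmanifold

end Lightlike

end LightlikeGeometry

end

open LightlikeGeometry

/-!
For sections `U, V` of the screen distribution, `D_U V` lies in `S(TM)` exactly when its radical
part `h̄^*(U, V)` vanishes. If the foliation is totally geodesic, both sides of the condition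
`h̄^*(U, J V) = p h̄^*(U, V)` are therefore zero, because `J V` is again a section of `S(TM)`.

Conversely, the condition for the pair `(U, J V)` reads `h̄^*(U, J² V) = p h̄^*(U, J V)`, and
`J² V = p J V + q V` turns it into `q h̄^*(U, V) = 0`, so that `h̄^* = 0` as `q ≠ 0`.
Integrability is then automatic: the torsion of the induced connection is
`π(V) J U - π(U) J V`, a section of `S(TM)` by invariance, so `[U, V]` is a combination of sections of `S(TM)`.

Two analytic facts carry the argument. The field `J V` on `M` is smooth, which is known a priori
only for its image along the immersion: `contMDiffAt_of_mfderiv_injective` inverts the differential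
by a smooth family of left inverses. The pullback to `M` of the Levi-Civita connection is torsion
free, `IsLeviCivita.derivAlong_sub`: in coordinates of the ambient manifold this combines the
commutator formula `mvfderiv_apply_mlieBracket` for the coordinates of the immersion with the
vanishing of the brackets of coordinate fields, `mlieBracket_symmL_const`.
-/

namespace LightlikeGeometry

section

open VectorField Bundle Filter
open scoped Topology

/-! ### Lie brackets and derivatives of vector-valued functions -/

section Bracket

variable {E H F M : Type*} [NormedAddCommGroup E] [NormedSpace ℝ E]
  [NormedAddCommGroup F] [NormedSpace ℝ F] [TopologicalSpace H] {I : ModelWithCorners ℝ E H}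
  [I.Boundaryless] [TopologicalSpace M] [ChartedSpace H M] [IsManifold I 2 M]

theorem contDiffAt_comp_extChartAt_symm {φ : M → F} {x y : M} (hφ : ContMDiffAt I 𝓘(ℝ, F) 2 φ y)
    (hy : y ∈ (extChartAt I x).source) :
    ContDiffAt ℝ 2 (φ ∘ (extChartAt I x).symm) (extChartAt I x y) := by
  have hsymm : ContMDiffAt 𝓘(ℝ, E) I 2 (extChartAt I x).symm (extChartAt I x y) :=
    (contMDiffOn_extChartAt_symm x).contMDiffAt
      (extChartAt_target_mem_nhds' ((extChartAt I x).map_source hy))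
  refine ContMDiffAt.contDiffAt (ContMDiffAt.comp _ ?_ hsymm)
  rwa [(extChartAt I x).left_inv hy]

/-- The directional derivative of `φ` along a field `W`, read in the chart around `x`. -/
theorem mvfderiv_apply_eventuallyEq {φ : M → F} {x : M}
    (hφ : ContMDiffAt I 𝓘(ℝ, F) 2 φ x) (W : ∀ y : M, TangentSpace I y) :
    (fun y ↦ mvfderiv I φ y (W y)) =ᶠ[𝓝 x]
      (fun z ↦ fderiv ℝ (φ ∘ (extChartAt I x).symm) z
        (mpullbackWithin 𝓘(ℝ, E) I (extChartAt I x).symm W (Set.range I) z)) ∘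
          extChartAt I x := by
  have : IsManifold I 1 M := .of_le (n := 2) (by norm_num)
  have h1 := eventuallyEq_mpullback_mpullbackWithin_extChartAt (s := Set.univ) (x := x) W
  rw [nhdsWithin_univ] at h1
  have h2 : ∀ᶠ y in 𝓝 x, ContMDiffAt I 𝓘(ℝ, F) 2 φ y :=
    (contMDiffAt_iff_contMDiffAt_nhds (by norm_num)).1 hφ
  filter_upwards [h1, h2, extChartAt_source_mem_nhds (I := I) x,
    eventually_eventually_nhds.2 (extChartAt_source_mem_nhds (I := I) x)] with y hW hy hys hys'
  have hd : MDifferentiableAt I 𝓘(ℝ, E) (extChartAt I x) y :=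
    mdifferentiableAt_extChartAt (by simpa using hys)
  have hcomp : DifferentiableAt ℝ (φ ∘ (extChartAt I x).symm) (extChartAt I x y) :=
    (contDiffAt_comp_extChartAt_symm hy hys).differentiableAt two_ne_zero
  have hev : φ =ᶠ[𝓝 y] (φ ∘ (extChartAt I x).symm) ∘ extChartAt I x := by
    filter_upwards [hys'] with z hz
    exact congrArg φ ((extChartAt I x).left_inv hz).symm
  change mfderiv I 𝓘(ℝ, F) φ y (W y) = _
  rw [hev.mfderiv_eq, mfderiv_comp y hcomp.mdifferentiableAt hd, mfderiv_eq_fderiv]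
  change fderiv ℝ _ _ (mfderiv I 𝓘(ℝ, E) (extChartAt I x) y (W y)) = _
  refine congrArg _ ?_
  rw [hW, mpullback_apply]
  exact (isInvertible_mfderiv_extChartAt (I := I) hys).self_apply_inverse _

/-- The derivative of a vector-valued function along a Lie bracket is the commutator of its
iterated directional derivatives. -/
theorem mvfderiv_apply_mlieBracket [CompleteSpace E] {φ : M → F} {x : M}
    (hφ : ContMDiffAt I 𝓘(ℝ, F) 2 φ x)
    {V W : ∀ y : M, TangentSpace I y}
    (hV : MDifferentiableAt I I.tangent (fun y ↦ (⟨y, V y⟩ : TangentBundle I M)) x)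
    (hW : MDifferentiableAt I I.tangent (fun y ↦ (⟨y, W y⟩ : TangentBundle I M)) x) :
    mvfderiv I φ x (mlieBracket I V W x) =
      mvfderiv I (fun y ↦ mvfderiv I φ y (W y)) x (V x) -
        mvfderiv I (fun y ↦ mvfderiv I φ y (V y)) x (W x) := by
  have : IsManifold I 1 M := .of_le (n := 2) (by norm_num)
  have hx := mem_extChartAt_source (I := I) x
  have hψ := contDiffAt_comp_extChartAt_symm hφ hx
  -- The chart expression of a field is differentiable at the base point.
  have hdiff : ∀ {W : ∀ y : M, TangentSpace I y},
      MDifferentiableAt I I.tangent (fun y ↦ (⟨y, W y⟩ : TangentBundle I M)) x →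
      DifferentiableAt ℝ (F := E) (mpullbackWithin 𝓘(ℝ, E) I (extChartAt I x).symm W (Set.range I))
        (extChartAt I x x) := fun {W} h ↦ by
    have := MDifferentiableWithinAt.differentiableWithinAt_mpullbackWithin_vectorField
      (mdifferentiableWithinAt_univ.2 h)
    rw [Set.preimage_univ, Set.univ_inter, I.range_eq_univ] at this
    rw [I.range_eq_univ]
    exact differentiableWithinAt_univ.1 this
  -- The iterated derivative, read in the chart.
  have hsecond : ∀ V {W : ∀ y : M, TangentSpace I y},
      MDifferentiableAt I I.tangent (fun y ↦ (⟨y, W y⟩ : TangentBundle I M)) x →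
      mvfderiv I (fun y ↦ mvfderiv I φ y (W y)) x (V x) =
        fderiv ℝ (fun z ↦ fderiv ℝ (φ ∘ (extChartAt I x).symm) z
          (mpullbackWithin 𝓘(ℝ, E) I (extChartAt I x).symm W (Set.range I) z)) (extChartAt I x x)
          (mpullbackWithin 𝓘(ℝ, E) I (extChartAt I x).symm V (Set.range I)
            (extChartAt I x x)) := fun V {W} h ↦ by
    have hd : MDifferentiableAt I 𝓘(ℝ, E) (extChartAt I x) x :=
      mdifferentiableAt_extChartAt (by simp)
    have hG : DifferentiableAt ℝ (fun z ↦ fderiv ℝ (φ ∘ (extChartAt I x).symm) z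
        (mpullbackWithin 𝓘(ℝ, E) I (extChartAt I x).symm W (Set.range I) z)) (extChartAt I x x) :=
      ((hψ.fderiv_right (m := 1) (by norm_num)).differentiableAt one_ne_zero).clm_apply (hdiff h)
    change mfderiv I 𝓘(ℝ, F) _ x (V x) = _
    rw [(mvfderiv_apply_eventuallyEq hφ W).mfderiv_eq, mfderiv_comp x hG.mdifferentiableAt hd,
      mfderiv_eq_fderiv]
    change fderiv ℝ _ _ (mfderiv I 𝓘(ℝ, E) (extChartAt I x) x (V x)) = _
    refine congrArg _ ?_
    have h1 := (eventuallyEq_mpullback_mpullbackWithin_extChartAt (s := Set.univ) (x := x) V)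
    rw [nhdsWithin_univ] at h1
    rw [h1.eq_of_nhds, mpullback_apply]
    exact (isInvertible_mfderiv_extChartAt (I := I) hx).self_apply_inverse _
  rw [hsecond V hW, hsecond W hV, ← fderiv_apply_lieBracket hψ (by simp) (hdiff hW) (hdiff hV)]
  change mfderiv I 𝓘(ℝ, F) φ x _ = _
  have hev : φ =ᶠ[𝓝 x] (φ ∘ (extChartAt I x).symm) ∘ extChartAt I x := by
    filter_upwards [extChartAt_source_mem_nhds (I := I) x] with z hz
    exact congrArg φ ((extChartAt I x).left_inv hz).symm
  rw [hev.mfderiv_eq, mfderiv_comp x (hψ.differentiableAt two_ne_zero).mdifferentiableAt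
    (mdifferentiableAt_extChartAt (by simp)), mfderiv_eq_fderiv]
  change fderiv ℝ _ _ (mfderiv I 𝓘(ℝ, E) (extChartAt I x) x _) = _
  refine congrArg _ ?_
  rw [← mlieBracketWithin_univ, mlieBracketWithin_apply]
  refine ((isInvertible_mfderiv_extChartAt (I := I) hx).self_apply_inverse _).trans ?_
  rw [Set.preimage_univ, Set.univ_inter, I.range_eq_univ]
  exact congrFun (lieBracketWithin_univ (E := E)) _

end Bracket

/-! ### Fields with constant coordinates -/

section CoordinateFields

variable {E H N : Type*} [NormedAddCommGroup E] [NormedSpace ℝ E]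
  [TopologicalSpace H] {I : ModelWithCorners ℝ E H}
  [TopologicalSpace N] [ChartedSpace H N] [IsManifold I ∞ N]

theorem contMDiffAt_symmL_const (y : N) (w : E) :
    ContMDiffAt I I.tangent ∞ (fun z ↦
      (⟨z, (trivializationAt E (TangentSpace I : N → Type _) y).symmL ℝ z w⟩ :
        TangentBundle I N)) y := by
  refine (contMDiffAt_section (F := E) (E := (TangentSpace I : N → Type _)) y).2 ?_
  refine (contMDiffAt_const (c := w)).congr_of_eventuallyEq ?_
  filter_upwards [(trivializationAt E (TangentSpace I : N → Type _) y).open_baseSet.mem_nhds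
    (FiberBundle.mem_baseSet_trivializationAt' y)] with z hz
  have := (trivializationAt E (TangentSpace I : N → Type _) y).continuousLinearMapAt_symmL
    (R := ℝ) hz w
  rwa [Trivialization.continuousLinearMapAt_apply, Trivialization.coe_linearMapAt_of_mem _ hz]
    at this

/-- The fields with constant coordinates in a chart commute at the base point of the chart, being
the pullbacks of constant fields. -/
theorem mlieBracket_symmL_const [CompleteSpace E] (y : N) (v w : E) :
    mlieBracket I (fun z ↦ (trivializationAt E (TangentSpace I : N → Type _) y).symmL ℝ z v)
      (fun z ↦ (trivializationAt E (TangentSpace I : N → Type _) y).symmL ℝ z w) y = 0 := by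
  have : IsManifold I 1 N := .of_le (n := ∞) (by simp)
  have hI3 : IsManifold I (minSmoothness ℝ 3) N := .of_le (n := ∞) (by
    rw [minSmoothness_of_isRCLikeNormedField]; exact WithTop.coe_le_coe.2 (le_top : (3 : ℕ∞) ≤ ⊤))
  have key : ∀ v : E, (fun z ↦ (trivializationAt E (TangentSpace I : N → Type _) y).symmL ℝ z v)
      =ᶠ[𝓝 y] mpullback I 𝓘(ℝ, E) (extChartAt I y) (fun _ ↦ v) := fun v ↦ by
    filter_upwards [extChartAt_source_mem_nhds (I := I) y] with z hz
    refine (DFunLike.congr_fun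
      (TangentBundle.symmL_trivializationAt (by simpa using hz)) v).trans ?_
    exact (DFunLike.congr_fun (ContinuousLinearMap.inverse_eq
      (mfderiv_extChartAt_comp_mfderivWithin_extChartAt_symm' hz)
      (mfderivWithin_extChartAt_symm_comp_mfderiv_extChartAt' hz)) v).symm
  rw [(key v).mlieBracket_vectorField_eq (key w)]
  have hc : ∀ v : E, MDifferentiableAt 𝓘(ℝ, E) 𝓘(ℝ, E).tangent
      (fun z : E ↦ (⟨z, v⟩ : TangentBundle 𝓘(ℝ, E) E)) (extChartAt I y y) := fun v ↦
    (contMDiffAt_vectorSpace_iff_contDiffAt (n := 1) (V := fun _ ↦ v)).2 contDiffAt_const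
      |>.mdifferentiableAt one_ne_zero
  rw [← mpullback_mlieBracket (n := 2) (hc v) (hc w) (contMDiffAt_extChartAt) (by simp),
    mpullback_apply]
  have h0 : mlieBracket 𝓘(ℝ, E) (fun _ : E ↦ v) (fun _ : E ↦ w) (extChartAt I y y) = 0 := by
    refine (congrFun (mlieBracketWithin_univ.symm.trans mlieBracketWithin_eq_lieBracketWithin)
      _).trans ?_
    simp [lieBracketWithin]
    rfl
  exact (congrArg _ h0).trans (map_zero _)

end CoordinateFields

/-! ### The derivative of a field along a map -/

section Along

variable {m d : ℕ} {M : Type*} [TopologicalSpace M] [ChartedSpace (EuclideanSpace ℝ (Fin m)) M]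
  {N : Type*} [TopologicalSpace N] [ChartedSpace (EuclideanSpace ℝ (Fin d)) N]
  [IsManifold (𝓡 d) ∞ N] {f : M → N} {x : M}

/-- The coordinate vector of `w ∈ T_zN` in the standard trivialization of `TN` around `y`; it is
meaningful only for `z` in the domain of the chart at `y`. -/
noncomputable def tangentCoord {d : ℕ} {N : Type*} [TopologicalSpace N]
    [ChartedSpace (EuclideanSpace ℝ (Fin d)) N] [IsManifold (𝓡 d) ∞ N] (y : N) {z : N}
    (w : TangentSpace (𝓡 d) z) : EuclideanSpace ℝ (Fin d) :=
  (trivializationAt (EuclideanSpace ℝ (Fin d)) (TangentSpace (𝓡 d) : N → Type _) y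
    (⟨z, w⟩ : TangentBundle (𝓡 d) N)).2

/-- The field on `N` whose coordinate vector around `y` is constantly `v`; it is zero outside the
domain of the chart at `y`. -/
noncomputable def constCoordField {d : ℕ} {N : Type*} [TopologicalSpace N]
    [ChartedSpace (EuclideanSpace ℝ (Fin d)) N] [IsManifold (𝓡 d) ∞ N] (y : N)
    (v : EuclideanSpace ℝ (Fin d)) (z : N) : TangentSpace (𝓡 d) z :=
  (trivializationAt (EuclideanSpace ℝ (Fin d)) (TangentSpace (𝓡 d) : N → Type _) y).symmL ℝ z v

theorem tangentCoord_eq_continuousLinearMapAt {y z : N}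
    (hz : z ∈ (chartAt (EuclideanSpace ℝ (Fin d)) y).source) (w : TangentSpace (𝓡 d) z) :
    tangentCoord y w = (trivializationAt (EuclideanSpace ℝ (Fin d))
      (TangentSpace (𝓡 d) : N → Type _) y).continuousLinearMapAt ℝ z w := by
  rw [Trivialization.continuousLinearMapAt_apply, Trivialization.coe_linearMapAt_of_mem _ hz]
  rfl

theorem tangentCoord_eq_mvfderiv {y z : N}
    (hz : z ∈ (chartAt (EuclideanSpace ℝ (Fin d)) y).source) (w : TangentSpace (𝓡 d) z) :
    tangentCoord y w = mvfderiv (𝓡 d) (extChartAt (𝓡 d) y) z w := by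
  rw [tangentCoord_eq_continuousLinearMapAt hz]
  exact DFunLike.congr_fun (TangentBundle.continuousLinearMapAt_trivializationAt hz) w

theorem constCoordField_tangentCoord (y : N) (w : TangentSpace (𝓡 d) y) :
    constCoordField y (tangentCoord y w) y = w := by
  rw [tangentCoord_eq_continuousLinearMapAt (mem_chart_source _ y)]
  exact Trivialization.symmL_continuousLinearMapAt _ (FiberBundle.mem_baseSet_trivializationAt' y) w

/-- `derivAlong` is by definition the coordinate formula for the pullback connection. -/
theorem derivAlong_eq (D : LinearConnection d N) (f : M → N)
    (W : ∀ x : M, TangentSpace (𝓡 d) (f x)) (x : M) (u : TangentSpace (𝓡 m) x) :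
    derivAlong D f W x u =
      constCoordField (f x) (mvfderiv (𝓡 m) (fun y ↦ tangentCoord (f x) (W y)) x u) (f x) +
        D (constCoordField (f x) (tangentCoord (f x) (W x))) (f x) (mfderiv (𝓡 m) (𝓡 d) f x u) :=
  rfl

theorem constCoordField_add (y : N) (v w : EuclideanSpace ℝ (Fin d)) :
    constCoordField y (v + w) = constCoordField y v + constCoordField y w :=
  funext fun _ ↦ map_add _ _ _

theorem constCoordField_smul (y : N) (a : ℝ) (v : EuclideanSpace ℝ (Fin d)) :
    constCoordField y (a • v) = a • constCoordField y v :=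
  funext fun _ ↦ map_smul _ _ _

theorem mdifferentiableAt_constCoordField (y : N) (v : EuclideanSpace ℝ (Fin d)) :
    MDifferentiableAt (𝓡 d) (𝓡 d).tangent
      (fun z ↦ (⟨z, constCoordField y v z⟩ : TangentBundle (𝓡 d) N)) y :=
  (contMDiffAt_symmL_const y v).mdifferentiableAt (by simp)

theorem mdifferentiableAt_tangentCoord {W : ∀ x : M, TangentSpace (𝓡 d) (f x)}
    (hW : MDifferentiableAt (𝓡 m) (𝓡 d).tangent
      (fun y ↦ (⟨f y, W y⟩ : TangentBundle (𝓡 d) N)) x) :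
    MDifferentiableAt (𝓡 m) 𝓘(ℝ, EuclideanSpace ℝ (Fin d))
      (fun y ↦ tangentCoord (f x) (W y)) x :=
  ((mdifferentiableAt_totalSpace _ _).1 hW).2

/-- The field `df V` along a smooth map `f` is smooth whenever `V` is. -/
theorem contMDiff_dmap [IsManifold (𝓡 m) ∞ M] (hf : ContMDiff (𝓡 m) (𝓡 d) ∞ f)
    {V : ∀ x : M, TangentSpace (𝓡 m) x}
    (hV : ContMDiff (𝓡 m) (𝓡 m).tangent ∞ (fun x ↦ (⟨x, V x⟩ : TangentBundle (𝓡 m) M))) :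
    ContMDiff (𝓡 m) (𝓡 d).tangent ∞
      (fun x ↦ (⟨f x, dmap m d f x (V x)⟩ : TangentBundle (𝓡 d) N)) :=
  have : IsManifold (𝓡 m) 1 M := .of_le (n := ∞) (by simp)
  have : IsManifold (𝓡 d) 1 N := .of_le (n := ∞) (by simp)
  (hf.contMDiff_tangentMap (m := ∞) (by simp)).comp hV

theorem derivAlong_add (D : LinearConnection d N) {W W' : ∀ x : M, TangentSpace (𝓡 d) (f x)}
    (hW : MDifferentiableAt (𝓡 m) (𝓡 d).tangent
      (fun y ↦ (⟨f y, W y⟩ : TangentBundle (𝓡 d) N)) x)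
    (hW' : MDifferentiableAt (𝓡 m) (𝓡 d).tangent
      (fun y ↦ (⟨f y, W' y⟩ : TangentBundle (𝓡 d) N)) x) (u : TangentSpace (𝓡 m) x) :
    derivAlong D f (fun y ↦ W y + W' y) x u = derivAlong D f W x u + derivAlong D f W' x u := by
  have hf : ContinuousAt f x := ((mdifferentiableAt_totalSpace _ _).1 hW).1.continuousAt
  have hc : (fun y ↦ tangentCoord (f x) (W y + W' y)) =ᶠ[𝓝 x]
      (fun y ↦ tangentCoord (f x) (W y)) + fun y ↦ tangentCoord (f x) (W' y) := by
    filter_upwards [hf (chart_source_mem_nhds (EuclideanSpace ℝ (Fin d)) (f x))] with y hy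
    simp only [Pi.add_apply, tangentCoord_eq_continuousLinearMapAt hy, map_add]
  have hd : mvfderiv (𝓡 m) (fun y ↦ tangentCoord (f x) (W y + W' y)) x =
      mvfderiv (𝓡 m) (fun y ↦ tangentCoord (f x) (W y)) x +
        mvfderiv (𝓡 m) (fun y ↦ tangentCoord (f x) (W' y)) x := by
    rw [← mvfderiv_add (mdifferentiableAt_tangentCoord hW) (mdifferentiableAt_tangentCoord hW')]
    exact hc.mfderiv_eq
  simp only [derivAlong_eq]
  rw [hd, hc.eq_of_nhds, Pi.add_apply, constCoordField_add,
    D.isCovariantDerivativeOnUniv.add (mdifferentiableAt_constCoordField _ _)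
      (mdifferentiableAt_constCoordField _ _), _root_.add_apply, constCoordField_add]
  simp only [_root_.add_apply, Pi.add_apply]
  abel

theorem derivAlong_const_smul (D : LinearConnection d N)
    {W : ∀ x : M, TangentSpace (𝓡 d) (f x)}
    (hW : MDifferentiableAt (𝓡 m) (𝓡 d).tangent
      (fun y ↦ (⟨f y, W y⟩ : TangentBundle (𝓡 d) N)) x) (a : ℝ) (u : TangentSpace (𝓡 m) x) :
    derivAlong D f (fun y ↦ a • W y) x u = a • derivAlong D f W x u := by
  have hf : ContinuousAt f x := ((mdifferentiableAt_totalSpace _ _).1 hW).1.continuousAt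
  have hc : (fun y ↦ tangentCoord (f x) (a • W y)) =ᶠ[𝓝 x]
      fun y ↦ a • tangentCoord (f x) (W y) := by
    filter_upwards [hf (chart_source_mem_nhds (EuclideanSpace ℝ (Fin d)) (f x))] with y hy
    simp only [tangentCoord_eq_continuousLinearMapAt hy, map_smul]
  have hd : mvfderiv (𝓡 m) (fun y ↦ tangentCoord (f x) (a • W y)) x =
      a • mvfderiv (𝓡 m) (fun y ↦ tangentCoord (f x) (W y)) x :=
    hc.mfderiv_eq.trans (const_smul_mfderiv (mdifferentiableAt_tangentCoord hW) a)
  simp only [derivAlong_eq]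
  rw [hd, hc.eq_of_nhds, constCoordField_smul,
    D.isCovariantDerivativeOnUniv.smul_const _ (mdifferentiableAt_constCoordField _ _),
    _root_.smul_apply, _root_.smul_apply, constCoordField_smul, Pi.smul_apply, smul_add]

theorem derivAlong_quarterSymmetric {g : SemiRiemannianMetric d N} {p q : ℕ}
    (J : MetallicStructure g p q) (nabla : LinearConnection d N)
    (eta : ∀ y : N, TangentSpace (𝓡 d) y) (W : ∀ x : M, TangentSpace (𝓡 d) (f x))
    (u : TangentSpace (𝓡 m) x) :
    derivAlong (quarterSymmetric J nabla eta) f W x u = derivAlong nabla f W x u +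
      g.inner (f x) (W x) (eta (f x)) • J.toFun (f x) (mfderiv (𝓡 m) (𝓡 d) f x u) := by
  simp only [derivAlong_eq, add_assoc]
  congr 1
  change _ + g.inner (f x) (constCoordField (f x) (tangentCoord (f x) (W x)) (f x)) (eta (f x)) •
    J.toFun (f x) (mfderiv (𝓡 m) (𝓡 d) f x u) = _
  rw [constCoordField_tangentCoord]
  rfl

/-- For a smooth map, the pullback of a torsion free connection is torsion free:
`D_U (df V) - D_V (df U) = df [U, V]`. -/
theorem IsLeviCivita.derivAlong_sub [IsManifold (𝓡 m) ∞ M] {g : SemiRiemannianMetric d N}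
    {nabla : LinearConnection d N} (hnabla : IsLeviCivita g nabla) (hf : ContMDiff (𝓡 m) (𝓡 d) ∞ f)
    {U V : ∀ x : M, TangentSpace (𝓡 m) x}
    (hU : MDifferentiableAt (𝓡 m) (𝓡 m).tangent (fun y ↦ (⟨y, U y⟩ : TangentBundle (𝓡 m) M)) x)
    (hV : MDifferentiableAt (𝓡 m) (𝓡 m).tangent (fun y ↦ (⟨y, V y⟩ : TangentBundle (𝓡 m) M)) x) :
    derivAlong nabla f (fun y ↦ dmap m d f y (V y)) x (U x) -
      derivAlong nabla f (fun y ↦ dmap m d f y (U y)) x (V x) =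
      dmap m d f x (mlieBracket (𝓡 m) U V x) := by
  have : IsManifold (𝓡 m) 2 M := .of_le (n := ∞) (WithTop.coe_le_coe.2 (le_top : (2 : ℕ∞) ≤ ⊤))
  have : IsManifold (𝓡 m) 1 M := .of_le (n := ∞) (by simp)
  have : IsManifold (𝓡 d) 1 N := .of_le (n := ∞) (by simp)
  have hφ : ContMDiffAt (𝓡 m) 𝓘(ℝ, EuclideanSpace ℝ (Fin d)) 2 (extChartAt (𝓡 d) (f x) ∘ f) x :=
    ((contMDiffAt_extChartAt (n := ∞)).comp x (hf x)).of_le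
      (WithTop.coe_le_coe.2 (le_top : (2 : ℕ∞) ≤ ⊤))
  -- The coordinates of `df V` are the derivatives along `V` of the coordinates of `f`.
  have hpt : ∀ y, f y ∈ (chartAt (EuclideanSpace ℝ (Fin d)) (f x)).source →
      ∀ v : TangentSpace (𝓡 m) y, tangentCoord (f x) (dmap m d f y v) =
        mvfderiv (𝓡 m) (extChartAt (𝓡 d) (f x) ∘ f) y v := fun y hy v ↦ by
    rw [tangentCoord_eq_mvfderiv hy]
    exact (DFunLike.congr_fun (mfderiv_comp y (mdifferentiableAt_extChartAt hy)
      ((hf y).mdifferentiableAt (by simp))) v).symm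
  have hcoord : ∀ V : ∀ x : M, TangentSpace (𝓡 m) x,
      (fun y ↦ tangentCoord (f x) (dmap m d f y (V y))) =ᶠ[𝓝 x]
        fun y ↦ mvfderiv (𝓡 m) (extChartAt (𝓡 d) (f x) ∘ f) y (V y) := fun V ↦ by
    filter_upwards [hf.continuous.continuousAt
      (chart_source_mem_nhds (EuclideanSpace ℝ (Fin d)) (f x))] with y hy
    exact hpt y hy _
  have hd : ∀ V : ∀ x : M, TangentSpace (𝓡 m) x,
      mvfderiv (𝓡 m) (fun y ↦ tangentCoord (f x) (dmap m d f y (V y))) x =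
        mvfderiv (𝓡 m) (fun y ↦ mvfderiv (𝓡 m) (extChartAt (𝓡 d) (f x) ∘ f) y (V y)) x :=
    fun V ↦ (hcoord V).mfderiv_eq
  set X := constCoordField (f x) (tangentCoord (f x) (dmap m d f x (U x))) with hX
  set Y := constCoordField (f x) (tangentCoord (f x) (dmap m d f x (V x))) with hY
  have htor := hnabla.torsion_free (X := X) (Y := Y) (y := f x)
    (mdifferentiableAt_constCoordField _ _) (mdifferentiableAt_constCoordField _ _)
  have hXY : mlieBracket (𝓡 d) X Y (f x) = 0 := mlieBracket_symmL_const _ _ _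
  rw [hXY, hX, hY, constCoordField_tangentCoord, constCoordField_tangentCoord, sub_eq_zero] at htor
  have hbr := constCoordField_tangentCoord (f x) (dmap m d f x (mlieBracket (𝓡 m) U V x))
  rw [hpt x (mem_chart_source _ _), mvfderiv_apply_mlieBracket hφ hU hV, ← hd U, ← hd V] at hbr
  rw [← hbr, derivAlong_eq, derivAlong_eq]
  refine (sub_eq_sub_iff_add_eq_add.2 ?_).trans (map_sub _ _ _).symm
  have : nabla Y (f x) (mfderiv (𝓡 m) (𝓡 d) f x (U x)) =
    nabla X (f x) (mfderiv (𝓡 m) (𝓡 d) f x (V x)) := htor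
  rw [this]
  have habc : ∀ a b c : TangentSpace (𝓡 d) (f x), a + c + b = a + (b + c) := fun a b c ↦ by abel
  exact habc _ _ _

end Along

/-! ### Smoothness of fields lifted through an immersion -/

section Lift

variable {E E' H H' M N : Type*} [NormedAddCommGroup E] [NormedSpace ℝ E] [FiniteDimensional ℝ E]
  [NormedAddCommGroup E'] [NormedSpace ℝ E'] [FiniteDimensional ℝ E']
  [TopologicalSpace H] {I : ModelWithCorners ℝ E H} [TopologicalSpace H']
  {I' : ModelWithCorners ℝ E' H'} [TopologicalSpace M] [ChartedSpace H M] [IsManifold I ∞ M]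
  [TopologicalSpace N] [ChartedSpace H' N] [IsManifold I' ∞ N]

/-- A vector field on `M` is smooth if its image under the differential of a smooth immersion is a
smooth field along the immersion. -/
theorem contMDiffAt_of_mfderiv_injective {f : M → N} {x : M} (hf : ContMDiffAt I I' ∞ f x)
    (hinj : Function.Injective (mfderiv I I' f x)) {W : ∀ y : M, TangentSpace I y}
    (hW : ContMDiffAt I I'.tangent ∞
      (fun y ↦ (⟨f y, mfderiv I I' f y (W y)⟩ : TangentBundle I' N)) x) :
    ContMDiffAt I I.tangent ∞ (fun y ↦ (⟨y, W y⟩ : TangentBundle I M)) x := by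
  have : CompleteSpace E := FiniteDimensional.complete ℝ E
  have : IsManifold I 1 M := .of_le (n := ∞) (by simp)
  have : IsManifold I' 1 N := .of_le (n := ∞) (by simp)
  set e := trivializationAt E (TangentSpace I : M → Type _) x
  set e' := trivializationAt E' (TangentSpace I' : N → Type _) (f x)
  have hx : x ∈ e.baseSet := FiberBundle.mem_baseSet_trivializationAt' x
  have hfx : f x ∈ e'.baseSet := FiberBundle.mem_baseSet_trivializationAt' (f x)
  -- The differential of `f` in coordinates.
  set A : M → E →L[ℝ] E' := fun y ↦
    ContinuousLinearMap.inCoordinates E (TangentSpace I : M → Type _) E'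
      (TangentSpace I' : N → Type _) x y (f x) (f y) (mfderiv I I' f y)
  have hAsmooth : ContMDiffAt I 𝓘(ℝ, E →L[ℝ] E') ∞ A x := hf.mfderiv_const (by simp)
  have hAx : Function.Injective (A x) := by
    have h : A x = _ := ContinuousLinearMap.inCoordinates_eq hx hfx
    rw [h]
    exact (e'.continuousLinearEquivAt ℝ (f x) hfx).injective.comp
      (hinj.comp (e.continuousLinearEquivAt ℝ x hx).symm.injective)
  obtain ⟨P, hP⟩ := LinearMap.exists_leftInverse_of_injective (A x).toLinearMap
    (LinearMap.ker_eq_bot.2 hAx)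
  -- `B` is the differential of `f` followed by a fixed left inverse of its value at `x`.
  set B : M → E →L[ℝ] E := fun y ↦ P.toContinuousLinearMap ∘L A y
  have hBsmooth : ContMDiffAt I 𝓘(ℝ, E →L[ℝ] E) ∞ B x :=
    contMDiffAt_const.clm_comp hAsmooth
  have hBx : B x = (ContinuousLinearEquiv.refl ℝ E : E →L[ℝ] E) := by
    ext v
    exact LinearMap.congr_fun hP v
  have hinv : ContMDiffAt I 𝓘(ℝ, E →L[ℝ] E) ∞ (fun y ↦ (B y).inverse) x := by
    refine ContMDiffAt.comp (g := ContinuousLinearMap.inverse) x ?_ hBsmooth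
    rw [hBx]
    exact (contDiffAt_map_inverse (ContinuousLinearEquiv.refl ℝ E)).contMDiffAt
  have hBev : ∀ᶠ y in 𝓝 x, B y ∈ Set.range ((↑) : (E ≃L[ℝ] E) → E →L[ℝ] E) :=
    hBsmooth.continuousAt (by rw [hBx]; exact ContinuousLinearEquiv.nhds _)
  refine (contMDiffAt_section (F := E) (E := (TangentSpace I : M → Type _)) x).2 ?_
  have hW' : ContMDiffAt I 𝓘(ℝ, E') ∞ (fun y ↦ (e' ⟨f y, mfderiv I I' f y (W y)⟩).2) x :=
    (contMDiffAt_totalSpace.1 hW).2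
  have hPW : ContMDiffAt I 𝓘(ℝ, E) ∞
      (fun y ↦ P.toContinuousLinearMap (e' ⟨f y, mfderiv I I' f y (W y)⟩).2) x :=
    contMDiffAt_const.clm_apply hW'
  refine (hinv.clm_apply hPW).congr_of_eventuallyEq ?_
  filter_upwards [hBev, e.open_baseSet.mem_nhds hx,
    hf.continuousAt (e'.open_baseSet.mem_nhds hfx)] with y ⟨b, hb⟩ hy hfy
  have hAy : A y (e ⟨y, W y⟩).2 = (e' ⟨f y, mfderiv I I' f y (W y)⟩).2 := by
    have h : A y = _ := ContinuousLinearMap.inCoordinates_eq hy hfy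
    rw [h]
    change (e'.continuousLinearEquivAt ℝ (f y) hfy) (mfderiv I I' f y
      ((e.continuousLinearEquivAt ℝ y hy).symm (e.continuousLinearEquivAt ℝ y hy (W y)))) = _
    rw [ContinuousLinearEquiv.symm_apply_apply]
    rfl
  have hBy : P.toContinuousLinearMap (e' ⟨f y, mfderiv I I' f y (W y)⟩).2 =
      b (e ⟨y, W y⟩).2 := by
    rw [← hAy]
    exact (DFunLike.congr_fun hb _).symm
  rw [hBy, ← hb, ContinuousLinearMap.inverse_equiv]
  exact (b.symm_apply_apply _).symm

end Lift

/-! ### Invariant lightlike submanifolds -/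

namespace LightlikeSubmanifold

variable {m d : ℕ} {M : Type*} [TopologicalSpace M] [ChartedSpace (EuclideanSpace ℝ (Fin m)) M]
  [IsManifold (𝓡 m) ∞ M]
  {N : Type*} [TopologicalSpace N] [ChartedSpace (EuclideanSpace ℝ (Fin d)) N]
  [IsManifold (𝓡 d) ∞ N]
  {g : SemiRiemannianMetric d N} {f : M → N} {r : ℕ} (L : LightlikeSubmanifold m g f r)
  {p q : ℕ} {J : MetallicStructure g p q}

theorem tangentPart_dmap (x : M) (v : TangentSpace (𝓡 m) x) :
    L.tangentPart x (dmap m d f x v) = v :=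
  LinearMap.linearProjOfIsCompl_apply_left ..

theorem hStar_eq_zero_iff (D : LinearConnection d N) (U V : ∀ x : M, TangentSpace (𝓡 m) x)
    (x : M) : L.hStar D U V x = 0 ↔ L.induced D U V x ∈ L.screen x :=
  Submodule.projection_apply_eq_zero_iff _

variable {L} in
theorem IsInvariant.exists_mem_screen (hL : L.IsInvariant J) {x : M}
    {v : TangentSpace (𝓡 m) x} (hv : v ∈ L.screen x) :
    ∃ w ∈ L.screen x, dmap m d f x w = J.toFun (f x) (dmap m d f x v) := by
  have h : J.toFun (f x) (dmap m d f x v) ∈ (L.screen x).map (dmap m d f x) :=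
    hL.screen x ▸ Submodule.mem_map_of_mem (Submodule.mem_map_of_mem hv)
  simpa using h

variable {L} in
theorem IsInvariant.tangentJ_mem (hL : L.IsInvariant J) {V : ∀ x : M, TangentSpace (𝓡 m) x}
    {x : M} (hV : V x ∈ L.screen x) : L.tangentJ J V x ∈ L.screen x := by
  obtain ⟨w, hw, h⟩ := hL.exists_mem_screen hV
  rwa [tangentJ, ← h, tangentPart_dmap]

variable {L} in
theorem IsInvariant.dmap_tangentJ (hL : L.IsInvariant J) {V : ∀ x : M, TangentSpace (𝓡 m) x}
    {x : M} (hV : V x ∈ L.screen x) :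
    dmap m d f x (L.tangentJ J V x) = J.toFun (f x) (dmap m d f x (V x)) := by
  obtain ⟨w, hw, h⟩ := hL.exists_mem_screen hV
  rw [tangentJ, ← h, tangentPart_dmap]

variable {L} in
theorem IsInvariant.tangentJ_tangentJ (hL : L.IsInvariant J) {V : ∀ x : M, TangentSpace (𝓡 m) x}
    {x : M} (hV : V x ∈ L.screen x) :
    L.tangentJ J (L.tangentJ J V) x = (p : ℝ) • L.tangentJ J V x + (q : ℝ) • V x := by
  rw [tangentJ, hL.dmap_tangentJ hV, J.sq, map_add, map_smul, map_smul, tangentPart_dmap]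
  rfl

variable {L} in
theorem IsInvariant.isSection_tangentJ (hL : L.IsInvariant J) {V : ∀ x : M, TangentSpace (𝓡 m) x}
    (hV : IsSection L.screen V) : IsSection L.screen (L.tangentJ J V) where
  mem x := hL.tangentJ_mem (hV.mem x)
  smooth x := by
    refine contMDiffAt_of_mfderiv_injective (L.smooth x) (L.immersion x) ?_
    have h : ∀ y, mfderiv (𝓡 m) (𝓡 d) f y (L.tangentJ J V y) =
        J.toFun (f y) (dmap m d f y (V y)) := fun y ↦ hL.dmap_tangentJ (hV.mem y)
    simp only [h]
    exact ((J.contMDiff.comp L.smooth).clm_bundle_apply (contMDiff_dmap L.smooth hV.smooth)) x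

/-- `h̄^*(U, a V + b W) = a h̄^*(U, V) + b h̄^*(U, W)` for constants `a` and `b`. -/
theorem hStar_add_smul (D : LinearConnection d N) (U : ∀ x : M, TangentSpace (𝓡 m) x)
    {V W : ∀ x : M, TangentSpace (𝓡 m) x} (hV : IsSection L.screen V) (hW : IsSection L.screen W)
    (a b : ℝ) (x : M) :
    L.hStar D U (fun y ↦ a • V y + b • W y) x = a • L.hStar D U V x + b • L.hStar D U W x := by
  have hsmul : ∀ (c : ℝ) {V : ∀ x : M, TangentSpace (𝓡 m) x}, IsSection L.screen V →
      ContMDiff (𝓡 m) (𝓡 m).tangent ∞ (fun y ↦ (⟨y, c • V y⟩ : TangentBundle (𝓡 m) M)) :=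
    fun c V h ↦ h.smooth.const_smul_section
  have hmd : ∀ {V : ∀ x : M, TangentSpace (𝓡 m) x},
      ContMDiff (𝓡 m) (𝓡 m).tangent ∞ (fun y ↦ (⟨y, V y⟩ : TangentBundle (𝓡 m) M)) →
      MDifferentiableAt (𝓡 m) (𝓡 d).tangent
        (fun y ↦ (⟨f y, dmap m d f y (V y)⟩ : TangentBundle (𝓡 d) N)) x :=
    fun h ↦ (contMDiff_dmap L.smooth h x).mdifferentiableAt (by simp)
  simp only [hStar, induced, map_add, map_smul]
  have h1 := derivAlong_add D (hmd (hsmul a hV)) (hmd (hsmul b hW)) (U x)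
  simp only [map_smul] at h1
  rw [h1, derivAlong_const_smul D (hmd hV.smooth), derivAlong_const_smul D (hmd hW.smooth)]
  simp only [map_add, map_smul]

/-- The torsion of the connection induced by the quarter symmetric connection:
`D_U V - D_V U - [U, V] = π(V) J U - π(U) J V`. -/
theorem induced_sub_induced {nabla : LinearConnection d N} (hnabla : IsLeviCivita g nabla)
    (eta : ∀ y : N, TangentSpace (𝓡 d) y) {U V : ∀ x : M, TangentSpace (𝓡 m) x}
    (hU : IsSection L.screen U) (hV : IsSection L.screen V) (x : M) :
    L.induced (quarterSymmetric J nabla eta) U V x -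
        L.induced (quarterSymmetric J nabla eta) V U x =
      mlieBracket (𝓡 m) U V x + (g.inner (f x) (dmap m d f x (V x)) (eta (f x)) • L.tangentJ J U x -
        g.inner (f x) (dmap m d f x (U x)) (eta (f x)) • L.tangentJ J V x) := by
  have h := hnabla.derivAlong_sub L.smooth ((hU.smooth x).mdifferentiableAt (by simp))
    ((hV.smooth x).mdifferentiableAt (by simp))
  have hJ : ∀ W : ∀ x : M, TangentSpace (𝓡 m) x,
    L.tangentPart x (J.toFun (f x) (mfderiv (𝓡 m) (𝓡 d) f x (W x))) =
      L.tangentJ J W x := fun _ ↦ rfl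
  have h' := congrArg (L.tangentPart x) h
  rw [map_sub, tangentPart_dmap] at h'
  simp only [induced, derivAlong_quarterSymmetric, map_add, map_smul]
  rw [← h', hJ, hJ]
  abel

variable {L} in
/-- Over `S(TM)`, the torsion of the induced connection takes values in `S(TM)`, so integrability
follows from `D_U V ∈ Γ(S(TM))`, that is, from the vanishing of `h̄^*`. Replacing `V` by `J V` in
the condition on `h̄^*` and using `J² = p J + q I` leaves `q h̄^*(U, V) = 0`. -/
theorem IsInvariant.screenTotallyGeodesicFoliation_iff (hL : L.IsInvariant J)
    (hq : 0 < q) {nabla : LinearConnection d N} (hnabla : IsLeviCivita g nabla)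
    (eta : ∀ y : N, TangentSpace (𝓡 d) y) :
    L.ScreenTotallyGeodesicFoliation (quarterSymmetric J nabla eta) ↔
      ∀ U V : ∀ x : M, TangentSpace (𝓡 m) x, IsSection L.screen U → IsSection L.screen V →
        ∀ x : M, L.hStar (quarterSymmetric J nabla eta) U (L.tangentJ J V) x =
          (p : ℝ) • L.hStar (quarterSymmetric J nabla eta) U V x := by
  constructor
  · intro h U V hU hV x
    rw [(L.hStar_eq_zero_iff _ _ _ _).2 (h.totally_geodesic hU (hL.isSection_tangentJ hV) x),
      (L.hStar_eq_zero_iff _ _ _ _).2 (h.totally_geodesic hU hV x), smul_zero]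
  · intro h
    have hgeo : ∀ ⦃U V : ∀ x : M, TangentSpace (𝓡 m) x⦄, IsSection L.screen U →
        IsSection L.screen V →
        ∀ x, L.induced (quarterSymmetric J nabla eta) U V x ∈ L.screen x := by
      intro U V hU hV x
      have hJV := hL.isSection_tangentJ hV
      have hJJ : L.tangentJ J (L.tangentJ J V) =
          fun y ↦ (p : ℝ) • L.tangentJ J V y + (q : ℝ) • V y :=
        funext fun y ↦ hL.tangentJ_tangentJ (hV.mem y)
      -- The condition for `J V` reads `p h(U, J V) + q h(U, V) = p h(U, J V)`.
      have h1 := h U _ hU hJV x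
      rw [hJJ, L.hStar_add_smul _ _ hJV hV, add_eq_left, smul_eq_zero] at h1
      exact (L.hStar_eq_zero_iff _ _ _ _).1 (h1.resolve_left (by exact_mod_cast hq.ne'))
    refine ⟨fun U V hU hV x ↦ ?_, hgeo⟩
    have ht := L.induced_sub_induced (J := J) hnabla eta hU hV x
    rw [eq_sub_iff_add_eq.2 ht.symm]
    exact sub_mem (sub_mem (hgeo hU hV x) (hgeo hV hU x))
      (sub_mem (Submodule.smul_mem _ _ (hL.tangentJ_mem (hU.mem x)))
        (Submodule.smul_mem _ _ (hL.tangentJ_mem (hV.mem x))))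

end LightlikeSubmanifold

end

end LightlikeGeometry

theorem mainTheorem4 {m n p q r : ℕ} (hp : 0 < p) (hq : 0 < q)
    {M : Type*} [TopologicalSpace M] [T2Space M] [SecondCountableTopology M]
    [ChartedSpace (EuclideanSpace ℝ (Fin m)) M] [IsManifold (𝓡 m) ∞ M]
    {N : Type*} [TopologicalSpace N] [T2Space N] [SecondCountableTopology N]
    [ChartedSpace (EuclideanSpace ℝ (Fin (m + n))) N] [IsManifold (𝓡 (m + n)) ∞ N]
    (g : SemiRiemannianMetric (m + n) N) (J : MetallicStructure g p q)
    (nabla : LinearConnection (m + n) N) (hnabla : IsLeviCivita g nabla)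
    (eta : ∀ y : N, TangentSpace (𝓡 (m + n)) y)
    (heta : ContMDiff (𝓡 (m + n)) (𝓡 (m + n)).tangent ∞
      (fun y ↦ (⟨y, eta y⟩ : TangentBundle (𝓡 (m + n)) N)))
    (f : M → N) (L : LightlikeSubmanifold m g f r) (hL : L.IsInvariant J) :
    L.ScreenTotallyGeodesicFoliation (quarterSymmetric J nabla eta) ↔
      ∀ U V : ∀ x : M, TangentSpace (𝓡 m) x, IsSection L.screen U → IsSection L.screen V →
        ∀ x : M, L.hStar (quarterSymmetric J nabla eta) U (L.tangentJ J V) x =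
          (p : ℝ) • L.hStar (quarterSymmetric J nabla eta) U V x :=
  hL.screenTotallyGeodesicFoliation_iff hq hnabla eta
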